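/- **Setting.** Let $(\mathscr X,\|\cdot\|)$ and $(\mathscr Y,\|\cdot\|)$ be real normed spaces with duals $\mathscr X^*,\mathscr Y^*$, and let $X\subset\mathscr X$, $Y\subset\mathscr Y$ be compact and convex with diameters $D_X$, $D_Y$. Let $f_1,\dots,f_T$ be continuous convex-concave payoff functions on $X\times Y$ with bounded subgradients: for all $t$, $x\in X$, $y\in Y$, the function $f_t(\cdot,y)$ has at $x$ a subgradient of norm at most $G_X$, and $-f_t(x,\cdot)$ has at $y$ a subgradient of norm at most $G_Y$. Let $f_0$ be any continuous function on $X\times Y$. For a proper function $\varphi$ let $\varphi^\star(z)=\sup_x\langle z,x\rangle-\varphi(x)$ and let $B_\varphi(x,z)=\varphi(x)+\varphi^\star(z)-\langle z,x\rangle$ be its Fenchel coupling. Let $\phi$ on $\mathscr X$ and $\psi$ on $\mathscr Y$ be proper and $1$-strongly convex, i.e. $B_\phi(x,z)\ge\frac12\|x-y\|^2$ for all $x,y$ and all $z\in\partial\phi(y)$, and likewise for $\psi$. Assume that the couplings are Lipschitz in the first argument: $|B_\phi(x,z)-B_\phi(x',z)|\le L_\phi\|x-x'\|$ for all $x,x',\alpha\in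 X$ and $z\in\partial\phi(\alpha)$, and likewise for $\psi$ on $Y$ with constant $L_\psi$. Put $L=\max\{L_\phi,L_\psi\}$ and $D=\max\{D_X,D_Y\}$. **Algorithm.** OPPM starts at some $x_1\in X$, $y_1\in Y$ with subgradients $x_1^\phi\in\partial\phi(x_1)$, $y_1^\psi\in\partial\psi(y_1)$, and lets $(x_{t+1},y_{t+1})\in X\times Y$ be a saddle point (minimum in $x$, maximum in $y$) over $X\times Y$ of $$f_t(x,y)+\tfrac1{\eta_t}B_\phi(x,x_t^\phi)-\tfrac1{\gamma_t}B_\psi(y,y_t^\psi).$$ Here $x_{t+1}^\phi\in\partial\phi(x_{t+1})$ is the gradient of $\phi$ if $\phi$ is differentiable at $x_{t+1}$ in the directions pointing into $X$, and in general a subgradient occurring in the first-order optimality condition of the update: for some subgradient $g$ of $f_t(\cdot,y_{t+1})$ at $x_{t+1}$ one has $\langle\eta_t g+x_{t+1}^\phi-x_t^\phi,\,x_{t+1}-x\rangle\le0$ for all $x\in X$. The subgradient $y_{t+1}^\psi$ is chosen in the same way, with $-f_t(x_{t+1},\cdot)$ and $\gamma_t$. Let $x'_t\in\arg\min_{x\in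 X}f_t(x,y_t)$ and $y'_t\in\arg\max_{y\in Y}f_t(x_t,y)$ for $1\le t\le T$, let $x'_0\in X$, $y'_0\in Y$ be arbitrary, and let $C\ge C_T=\sum_{t=1}^T(\|x'_t-x'_{t-1}\|+\|y'_t-y'_{t-1}\|)$. With $(a)_+=\max(a,0)$ and a constant $\epsilon>0$, let the learning rates be $$\eta_t=\gamma_t=\frac{L(2D+C)}{\epsilon+\sum_{\tau=1}^{t-2}\Delta_\tau},\qquad \Delta_t=\Bigl(\Sigma_t-\max_{1\le\tau\le t-1}\Sigma_\tau\Bigr)_+,\qquad \Sigma_t=\max\{\Sigma^1_t,\Sigma^2_t\},$$ where the empty maximum is $0$ and $$\Sigma^1_t=\Bigl(\sum_{\tau=1}^{t}\bigl(f_\tau(x_\tau,y_\tau)-f_\tau(x_{\tau+1},y_{\tau+1})+f_\tau(x'_{\tau+1},y_{\tau+1})-f_\tau(x'_\tau,y_\tau)\bigr)\Bigr)_+,$$ $$\Sigma^2_t=\Bigl(\sum_{\tau=1}^{t}\bigl(f_\tau(x_\tau,y'_\tau)-f_\tau(x_{\tau+1},y'_{\tau+1})+f_\tau(x_{\tau+1},y_{\tau+1})-f_\tau(x_\tau,y_\tau)\bigr)\Bigr)_+.$$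 **Theorem (individual regret for OPPM).** There is a constant $K>0$, depending only on $D_X,D_Y,G_X,G_Y,L_\phi,L_\psi,\epsilon$ (and not on the spaces, the sets, the regularisers, the payoff functions, $T$ or $C$), such that both individual regrets $$\mathrm{Reg}^1_T=\sum_{t=1}^T f_t(x_t,y_t)-\sum_{t=1}^T f_t(x'_t,y_t),\qquad \mathrm{Reg}^2_T=\sum_{t=1}^T f_t(x_t,y'_t)-\sum_{t=1}^T f_t(x_t,y_t)$$ satisfy $$\mathrm{Reg}^1_T,\ \mathrm{Reg}^2_T\ \le\ K\min\Bigl\{1+\sum_{t=1}^T\rho(f_t,f_{t-1}),\ \sqrt{(1+C)T}\Bigr\},\qquad \rho(f,g)=\max_{x\in X,\,y\in Y}|f(x,y)-g(x,y)|.$$ -/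

import Mathlib

open Filter Topology

universe u v

noncomputable section

namespace OPPM

section Regularizer

variable {E : Type*} [NormedAddCommGroup E] [NormedSpace ℝ E]

/-- A proper extended-real-valued function. -/
def IsProper (φ : E → EReal) : Prop :=
  (∀ x, φ x ≠ ⊥) ∧ ∃ x, φ x ≠ ⊤

/-- The subdifferential of a proper function `φ` on the whole space. -/
def subdifferential (φ : E → EReal) (y : E) : Set (StrongDual ℝ E) :=
  {z | ∀ x, φ y + ((z (x - y) : ℝ) : EReal) ≤ φ x}

/-- The convex conjugate `φ⋆(z) = sup_x ⟨z, x⟩ - φ(x)`. -/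
def conjugate (φ : E → EReal) (z : StrongDual ℝ E) : EReal :=
  ⨆ x, ((z x : ℝ) : EReal) - φ x

/-- The Fenchel coupling `B_φ(x, z) = φ(x) + φ⋆(z) - ⟨z, x⟩`. -/
def fenchelCoupling (φ : E → EReal) (x : E) (z : StrongDual ℝ E) : EReal :=
  φ x + conjugate φ z - ((z x : ℝ) : EReal)

/-- `μ`-strong convexity: `B_φ(x, z) ≥ (μ / 2) ‖x - y‖ ^ 2` for all `x`, `y` and `z ∈ ∂φ(y)`. -/
def StronglyConvex (μ : ℝ) (φ : E → EReal) : Prop :=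
  ∀ x y, ∀ z ∈ subdifferential φ y,
    ((μ / 2 * ‖x - y‖ ^ 2 : ℝ) : EReal) ≤ fenchelCoupling φ x z

/-- `|B_φ(x, z) - B_φ(x', z)| ≤ L ‖x - x'‖` for all `x, x', α ∈ X` and `z ∈ ∂φ(α)`. The absolute
value is expressed by letting `x` and `x'` range over all pairs; as `B_φ(α, z) = 0`, the
inequality also says that `B_φ(·, z)` is finite on `X`. -/
def CouplingLipschitzOn (L : ℝ) (φ : E → EReal) (X : Set E) : Prop :=
  ∀ α ∈ X, ∀ z ∈ subdifferential φ α, ∀ x ∈ X, ∀ x' ∈ X,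
    fenchelCoupling φ x z ≤ fenchelCoupling φ x' z + ((L * ‖x - x'‖ : ℝ) : EReal)

/-- Subgradients at `a` of a real-valued function on the set `X`. -/
def subdifferentialOn (X : Set E) (h : E → ℝ) (a : E) : Set (StrongDual ℝ E) :=
  {g | ∀ x ∈ X, h a + g (x - a) ≤ h x}

/-- `p` is the (Gateaux) derivative of `φ` at `a` along the directions pointing into `X`. -/
def IsGradientAlong (X : Set E) (φ : E → EReal) (a : E) (p : StrongDual ℝ E) : Prop :=
  ∀ x ∈ X, Tendsto (fun s : ℝ => ((φ (a + s • (x - a))).toReal - (φ a).toReal) / s)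
    (𝓝[>] 0) (𝓝 (p (x - a)))

/-- `p'` is an admissible subgradient of `φ` at the point `a'` which minimises
`h + B_φ(·, p) / η` over `X`. If `φ` is differentiable at `a'` this is the gradient. At a kink of
`φ`, where there are several subgradients, it is one that occurs in the first-order optimality
condition `⟨η ∇h(a') + p' - p, a' - x⟩ ≤ 0` (for all `x ∈ X`) of that minimisation. -/
def IsUpdateSubgradient (X : Set E) (φ : E → EReal) (h : E → ℝ) (η : ℝ)
    (p : StrongDual ℝ E) (a' : E) (p' : StrongDual ℝ E) : Prop :=
  p' ∈ subdifferential φ a' ∧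
    (IsGradientAlong X φ a' p' ∨
      ∃ g ∈ subdifferentialOn X h a', ∀ x ∈ X, (η • g + p' - p) (a' - x) ≤ 0)

end Regularizer

section Game

variable {E : Type*} [NormedAddCommGroup E] [NormedSpace ℝ E]
variable {F : Type*} [NormedAddCommGroup F] [NormedSpace ℝ F]

/-- Continuous convex-concave payoff functions on `X × Y` with subgradients bounded by `GX`, `GY`.
It is enough that some subgradient of `f(·, y)` at `x`, relative to `X`, has norm at most `GX`,
and likewise for `-f(x, ·)`. -/
structure IsPayoff (X : Set E) (Y : Set F) (GX GY : ℝ) (f : E → F → ℝ) : Prop where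
  continuousOn : ContinuousOn (Function.uncurry f) (X ×ˢ Y)
  convexOn : ∀ y ∈ Y, ConvexOn ℝ X (fun x => f x y)
  concaveOn : ∀ x ∈ X, ConcaveOn ℝ Y (fun y => f x y)
  subgradient_left : ∀ x ∈ X, ∀ y ∈ Y,
    ∃ g ∈ subdifferentialOn X (fun a => f a y) x, ‖g‖ ≤ GX
  subgradient_right : ∀ x ∈ X, ∀ y ∈ Y,
    ∃ g ∈ subdifferentialOn Y (fun b => -f x b) y, ‖g‖ ≤ GY

/-- `ρ(f, g) = max_{x ∈ X, y ∈ Y} |f(x, y) - g(x, y)|`. -/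
def rho (X : Set E) (Y : Set F) (f g : E → F → ℝ) : ℝ :=
  sSup ((fun w : E × F => |f w.1 w.2 - g w.1 w.2|) '' (X ×ˢ Y))

variable (f : ℕ → E → F → ℝ) (x x' : ℕ → E) (y y' : ℕ → F)

/-- The individual regret of Player 1, `x' t` being a best response to `y t`. -/
def regret₁ (T : ℕ) : ℝ :=
  ∑ t ∈ Finset.Icc 1 T, f t (x t) (y t) - ∑ t ∈ Finset.Icc 1 T, f t (x' t) (y t)

/-- The individual regret of Player 2, `y' t` being a best response to `x t`. -/
def regret₂ (T : ℕ) : ℝ :=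
  ∑ t ∈ Finset.Icc 1 T, f t (x t) (y' t) - ∑ t ∈ Finset.Icc 1 T, f t (x t) (y t)

/-- `C_T`, the path length of the best responses. -/
def pathLength (T : ℕ) : ℝ :=
  ∑ t ∈ Finset.Icc 1 T, (‖x' t - x' (t - 1)‖ + ‖y' t - y' (t - 1)‖)

/-- `V_T`, the temporal variability of the payoff functions. -/
def variability (X : Set E) (Y : Set F) (T : ℕ) : ℝ :=
  ∑ t ∈ Finset.Icc 1 T, rho X Y (f t) (f (t - 1))

def sigma₁ (T : ℕ) : ℝ :=
  max (∑ t ∈ Finset.Icc 1 T,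
    (f t (x t) (y t) - f t (x (t + 1)) (y (t + 1))
      + f t (x' (t + 1)) (y (t + 1)) - f t (x' t) (y t))) 0

def sigma₂ (T : ℕ) : ℝ :=
  max (∑ t ∈ Finset.Icc 1 T,
    (f t (x t) (y' t) - f t (x (t + 1)) (y' (t + 1))
      + f t (x (t + 1)) (y (t + 1)) - f t (x t) (y t))) 0

def sigma (t : ℕ) : ℝ :=
  max (sigma₁ f x x' y t) (sigma₂ f x y y' t)

/-- `Δ_t = (Σ_t - max_{1 ≤ τ ≤ t - 1} Σ_τ)₊`; the empty maximum (for `t = 1`) is `0`. -/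
def delta (t : ℕ) : ℝ :=
  max (sigma f x x' y y' t - sSup (sigma f x x' y y' '' Set.Ico 1 t)) 0

/-- The common learning rate `η_t = γ_t = L (2 D + C) / (ε + ∑_{τ = 1}^{t - 2} Δ_τ)`. -/
def rate (L D C ε : ℝ) (t : ℕ) : ℝ :=
  L * (2 * D + C) / (ε + ∑ τ ∈ Finset.Icc 1 (t - 2), delta f x x' y y' τ)

/-- The objective `f(x, y) + B_φ(x, p) / η - B_ψ(y, q) / γ` of one update. -/
def proxObjective (φ : E → EReal) (ψ : F → EReal) (h : E → F → ℝ) (η γ : ℝ)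
    (p : StrongDual ℝ E) (q : StrongDual ℝ F) (a : E) (b : F) : EReal :=
  ((h a b : ℝ) : EReal) + ((1 / η : ℝ) : EReal) * fenchelCoupling φ a p
    - ((1 / γ : ℝ) : EReal) * fenchelCoupling ψ b q

/-- A play of `T` rounds of the online proximal point method with learning rates `η` (Player 1)
and `γ` (Player 2). The strategies are `x t`, `y t`; the subgradients used are `p t ∈ ∂φ(x t)` and
`q t ∈ ∂ψ(y t)`. -/
structure IsPlay (X : Set E) (Y : Set F) (φ : E → EReal) (ψ : F → EReal)
    (η γ : ℕ → ℝ) (p : ℕ → StrongDual ℝ E) (q : ℕ → StrongDual ℝ F) (T : ℕ) : Prop where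
  mem_left : ∀ t, 1 ≤ t → t ≤ T → x t ∈ X
  mem_right : ∀ t, 1 ≤ t → t ≤ T → y t ∈ Y
  init_left : p 1 ∈ subdifferential φ (x 1)
  init_right : q 1 ∈ subdifferential ψ (y 1)
  saddle : ∀ t, 1 ≤ t → t < T →
    IsSaddlePointOn X Y (proxObjective φ ψ (f t) (η t) (γ t) (p t) (q t)) (x (t + 1)) (y (t + 1))
  subgradient_left : ∀ t, 1 ≤ t → t < T →
    IsUpdateSubgradient X φ (fun a => f t a (y (t + 1))) (η t) (p t) (x (t + 1)) (p (t + 1))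
  subgradient_right : ∀ t, 1 ≤ t → t < T →
    IsUpdateSubgradient Y ψ (fun b => -f t (x (t + 1)) b) (γ t) (q t) (y (t + 1)) (q (t + 1))

/-- `x' t ∈ argmin_{a ∈ X} f_t(a, y_t)` and `y' t ∈ argmax_{b ∈ Y} f_t(x_t, b)` for `1 ≤ t ≤ T`;
the starting points `x' 0`, `y' 0` are arbitrary feasible points. -/
structure IsBestResponse (X : Set E) (Y : Set F) (T : ℕ) : Prop where
  mem_left : ∀ t ≤ T, x' t ∈ X
  mem_right : ∀ t ≤ T, y' t ∈ Y
  isMin : ∀ t, 1 ≤ t → t ≤ T → IsMinOn (fun a => f t a (y t)) X (x' t)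
  isMax : ∀ t, 1 ≤ t → t ≤ T → IsMaxOn (fun b => f t (x t) b) Y (y' t)

end Game

end OPPM

end

set_option linter.unusedSectionVars false

/-! Write `T = n + 1`. Each regret splits into three pieces: the signed sum inside `sigma₁` or
`sigma₂` up to `n`, the regret measured after each update, and the payoff gap of the last round,
which is at most `G * D`.

The post-update regret is a sum of proximal inequalities. By the three-point identity and summation
by parts along the moving comparator (`sum_prox_le`), it is at most `L * (D + path length) / η n`,
and the rate is tuned so that this is at most `ε + ∑ Δ`. The sum of the `Δ_t` is the running maximum
of `Σ_t` (`sum_max_sub_sSup`), so it also dominates the first piece. Hence both regrets are at most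
`ε + G * D + 2 * ∑ Δ` (`regret_le_sum_delta`).

Two independent estimates of `∑ Δ` then give the minimum. Rearranged, `Σ_t` compares successive
payoff functions at the same points, so it is bounded by boundary terms and the variability
(`sum_delta_le_variability`). On the other hand, strong convexity limits each move to `η t * G`, so
`Δ_t` is at most a multiple of `η t` plus the comparator's movement. As `η t` is inversely
proportional to `ε` plus an earlier partial sum of `Δ`, this is a quadratic inequality for `∑ Δ`,
whose solution has order `√((1 + C) T)` (`sum_delta_le_sqrt`). -/

namespace OPPM

/-! ### Fenchel couplings as real numbers, and the proximal inequality -/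

section Coupling

variable {E : Type*} [NormedAddCommGroup E] [NormedSpace ℝ E]
  {φ : E → EReal} {X : Set E} {L η : ℝ} {a a' b c : E} {p p' : StrongDual ℝ E}

theorem IsProper.ne_top_of_mem_subdifferential (hφ : IsProper φ) (hp : p ∈ subdifferential φ a) :
    φ a ≠ ⊤ := by
  obtain ⟨x, hx⟩ := hφ.2
  intro h
  have := hp x
  rw [h, EReal.top_add_coe, top_le_iff] at this
  exact hx this

/-- The value of the Fenchel coupling `B_φ(b, p)` for `p ∈ ∂φ(a)`, as a real number. -/
noncomputable def coupling (φ : E → EReal) (a : E) (p : StrongDual ℝ E) (b : E) : ℝ :=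
  (φ b).toReal - (φ a).toReal - p (b - a)

@[simp] theorem coupling_self : coupling φ a p a = 0 := by simp [coupling]

/-- Equality in Fenchel–Young: the subgradient inequality says exactly that the supremum is attained
at `a`. It turns the coupling into a Bregman-type divergence. -/
theorem IsProper.conjugate_eq (hφ : IsProper φ) (hp : p ∈ subdifferential φ a) :
    conjugate φ p = ((p a - (φ a).toReal : ℝ) : EReal) := by
  have ha := EReal.coe_toReal (hφ.ne_top_of_mem_subdifferential hp) (hφ.1 a)
  apply le_antisymm
  · refine iSup_le fun x => ?_
    by_cases hx : φ x = ⊤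
    · simp [hx]
    · have hx' := EReal.coe_toReal hx (hφ.1 x)
      have h := hp x
      rw [← ha, ← hx'] at h
      rw [← hx']
      norm_cast at h ⊢
      rw [map_sub] at h
      linarith
  · refine le_trans (le_of_eq ?_) (le_iSup (fun x => ((p x : ℝ) : EReal) - φ x) a)
    nth_rw 2 [← ha]
    norm_cast

theorem IsProper.fenchelCoupling_eq (hφ : IsProper φ) (hp : p ∈ subdifferential φ a)
    (hb : φ b ≠ ⊤) : fenchelCoupling φ b p = (coupling φ a p b : EReal) := by
  rw [fenchelCoupling, hφ.conjugate_eq hp, ← EReal.coe_toReal hb (hφ.1 b), coupling, map_sub]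
  norm_cast
  ring

/-- The coupling vanishes at `a`, so the Lipschitz bound keeps it finite on all of `X`. This is what
permits passing from `EReal` to `ℝ`. -/
theorem CouplingLipschitzOn.ne_top (hL : CouplingLipschitzOn L φ X) (hφ : IsProper φ)
    (ha : a ∈ X) (hp : p ∈ subdifferential φ a) (hb : b ∈ X) : φ b ≠ ⊤ := by
  intro h
  have := hL a ha p hp b hb a ha
  rw [hφ.fenchelCoupling_eq hp (hφ.ne_top_of_mem_subdifferential hp), fenchelCoupling, h,
    hφ.conjugate_eq hp, EReal.top_add_coe, EReal.top_sub_coe, ← EReal.coe_add, top_le_iff] at this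
  exact EReal.coe_ne_top _ this

theorem CouplingLipschitzOn.fenchelCoupling_eq (hL : CouplingLipschitzOn L φ X)
    (hφ : IsProper φ) (ha : a ∈ X) (hp : p ∈ subdifferential φ a) (hb : b ∈ X) :
    fenchelCoupling φ b p = (coupling φ a p b : EReal) :=
  hφ.fenchelCoupling_eq hp (hL.ne_top hφ ha hp hb)

theorem CouplingLipschitzOn.coupling_le (hL : CouplingLipschitzOn L φ X)
    (hφ : IsProper φ) (ha : a ∈ X) (hp : p ∈ subdifferential φ a) (hb : b ∈ X) (hc : c ∈ X) :
    coupling φ a p b ≤ coupling φ a p c + L * ‖b - c‖ := by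
  have := hL a ha p hp b hb c hc
  rw [hL.fenchelCoupling_eq hφ ha hp hb, hL.fenchelCoupling_eq hφ ha hp hc] at this
  exact_mod_cast this

theorem StronglyConvex.le_coupling (hs : StronglyConvex 1 φ) (hL : CouplingLipschitzOn L φ X)
    (hφ : IsProper φ) (ha : a ∈ X) (hp : p ∈ subdifferential φ a) (hb : b ∈ X) :
    1 / 2 * ‖b - a‖ ^ 2 ≤ coupling φ a p b := by
  have := hs b a p hp
  rw [hL.fenchelCoupling_eq hφ ha hp hb] at this
  exact_mod_cast this

/-- The three-point identity. -/
theorem coupling_three_point :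
    (p - p') (a' - c) = coupling φ a p c - coupling φ a' p' c - coupling φ a p a' := by
  simp only [coupling, sub_apply, map_sub]
  ring

/-- The first-order optimality condition of a proximal step. -/
theorem IsUpdateSubgradient.sub_le {h : E → ℝ}
    (hu : IsUpdateSubgradient X φ h η p a' p') (hX : Convex ℝ X) (hh : ConvexOn ℝ X h)
    (hη : 0 < η) (ha' : a' ∈ X)
    (hmin : ∀ x ∈ X, h a' + 1 / η * coupling φ a p a' ≤ h x + 1 / η * coupling φ a p x)
    (hc : c ∈ X) : h a' - h c ≤ 1 / η * (p - p') (a' - c) := by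
  rcases hu.2 with hg | ⟨g, hg, hopt⟩
  -- Gradient case: compare `a'` with points of the segment towards `c`, use convexity of `h`,
  -- divide by `s` and let `s → 0`.
  · have hlim := ((hg c hc).sub_const (p (c - a'))).const_mul (1 / η)
    have key : h a' - h c ≤ 1 / η * (p' (c - a') - p (c - a')) := by
      refine ge_of_tendsto hlim ?_
      have hmem : Set.Ioc (0 : ℝ) 1 ∈ 𝓝[>] (0 : ℝ) := Ioc_mem_nhdsGT one_pos
      filter_upwards [hmem] with s hs
      have hs0 : 0 < s := hs.1
      have he : a' + s • (c - a') = (1 - s) • a' + s • c := by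
        rw [smul_sub, sub_smul, one_smul]; abel
      have hx : a' + s • (c - a') ∈ X := by
        rw [he]; exact hX ha' hc (by linarith [hs.2]) hs0.le (by ring)
      have h1 := hmin _ hx
      have h2 : h (a' + s • (c - a')) ≤ (1 - s) * h a' + s * h c := by
        rw [he]; exact hh.2 ha' hc (by linarith [hs.2]) hs0.le (by ring)
      have h3 : coupling φ a p (a' + s • (c - a')) - coupling φ a p a'
          = (φ (a' + s • (c - a'))).toReal - (φ a').toReal - s * p (c - a') := by
        simp only [coupling, map_sub, map_add, map_smul, smul_eq_mul]; ring
      have h4 : s * (h a' - h c) ≤ 1 / η * ((φ (a' + s • (c - a'))).toReal - (φ a').toReal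
          - s * p (c - a')) := by
        rw [← h3, mul_sub]; linarith
      have h5 : 1 / η * (((φ (a' + s • (c - a'))).toReal - (φ a').toReal) / s - p (c - a'))
          = (1 / η * ((φ (a' + s • (c - a'))).toReal - (φ a').toReal - s * p (c - a'))) / s := by
        field_simp
      rw [h5, le_div_iff₀ hs0]
      linarith
    refine key.trans (le_of_eq ?_)
    simp only [sub_apply, map_sub]
    ring
  · have h1 := hg c hc
    have h2 := hopt c hc
    simp only [sub_apply, add_apply,
      smul_apply, smul_eq_mul, map_sub] at h1 h2 ⊢
    rw [one_div, inv_mul_eq_div, le_div_iff₀ hη]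
    nlinarith

end Coupling

/-! ### Inequalities for real sequences -/

section Sequences

variable {w a b c s d : ℕ → ℝ} {L R : ℝ}

/-- Summation by parts for a sum of weighted differences of potentials. -/
theorem sum_weighted_sub_le (hw0 : ∀ t, 0 ≤ w t) (hw : Monotone w) (n : ℕ)
    (hb : ∀ t, 1 ≤ t → t ≤ n + 1 → b t ≤ R) (hc : ∀ t, 0 ≤ L * c t)
    (ha : ∀ t, 1 ≤ t → t ≤ n → a t ≤ b t + L * c t) :
    ∑ t ∈ Finset.Icc 1 n, w t * (a t - b (t + 1))
      ≤ w n * (R + L * ∑ t ∈ Finset.Icc 1 n, c t - b (n + 1)) := by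
  induction n with
  | zero =>
    have := hb 1 le_rfl le_rfl
    simpa using mul_nonneg (hw0 0) (sub_nonneg.2 this)
  | succ n ih =>
    rw [Finset.sum_Icc_succ_top (by omega), Finset.sum_Icc_succ_top (by omega)]
    have h1 := ih (fun t h h' => hb t h (by omega)) (fun t h h' => ha t h (by omega))
    have h2 := ha (n + 1) (by omega) le_rfl
    have h3 := hb (n + 1) (by omega) (by omega)
    have h4 : 0 ≤ L * ∑ t ∈ Finset.Icc 1 n, c t := by
      rw [Finset.mul_sum]; exact Finset.sum_nonneg fun t _ => hc t
    -- The weight may be raised from `w n` to `w (n + 1)` because the bracket is nonnegative, by `b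
    -- (n + 1) ≤ R`.
    have h5 := mul_le_mul_of_nonneg_right (hw n.le_succ)
      (by linarith : 0 ≤ R + L * ∑ t ∈ Finset.Icc 1 n, c t - b (n + 1))
    have h6 := mul_le_mul_of_nonneg_left h2 (hw0 (n + 1))
    simp only [Nat.succ_eq_add_one] at h5
    linarith

/-- The positive increments of a nonnegative sequence over its past maxima add up to its running
maximum. -/
theorem sum_max_sub_sSup (hs : ∀ t, 0 ≤ s t) (n : ℕ) :
    ∑ t ∈ Finset.Icc 1 n, max (s t - sSup (s '' Set.Ico 1 t)) 0 = sSup (s '' Set.Ico 1 (n + 1)) := by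
  induction n with
  | zero => simp
  | succ n ih =>
    rw [Finset.sum_Icc_succ_top (by omega), ih]
    have h1 : Set.Ico 1 (n + 1 + 1) = insert (n + 1) (Set.Ico 1 (n + 1)) := by
      ext k; simp only [Set.mem_Ico, Set.mem_insert_iff]; omega
    have h2 : sSup (s '' Set.Ico 1 (n + 1 + 1)) = max (s (n + 1)) (sSup (s '' Set.Ico 1 (n + 1))) := by
      rw [h1, Set.image_insert_eq]
      -- In the empty case `sSup ∅ = 0`, which is harmless since `s` is nonnegative.
      rcases (Set.Ico 1 (n + 1)).eq_empty_or_nonempty with h | h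
      · simp [h, hs]
      · exact csSup_insert ((Set.finite_Ico _ _).image s).bddAbove (h.image s)
    rw [h2, ← max_add_add_left]
    simp

/-- A self-bounding estimate for sums whose increments are controlled by the reciprocal of the sum
two steps earlier. -/
theorem sum_sq_le_of_mul_le {ε A G B : ℝ} (hε : 0 ≤ ε) (hG : 0 ≤ G)
    (hd0 : ∀ t, 0 ≤ d t) (hc : ∀ t, 0 ≤ c t) (n : ℕ) (hB : 0 ≤ B)
    (hdB : ∀ t, 1 ≤ t → t ≤ n → d t ≤ B)
    (hd : ∀ t, 1 ≤ t → t ≤ n → d t * (ε + ∑ τ ∈ Finset.Icc 1 (t - 2), d τ)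
      ≤ A + G * c t * (ε + ∑ τ ∈ Finset.Icc 1 (t - 2), d τ)) :
    (∑ t ∈ Finset.Icc 1 n, d t) ^ 2 ≤ 2 * A * n
      + 2 * G * (∑ t ∈ Finset.Icc 1 n, c t) * (ε + ∑ t ∈ Finset.Icc 1 n, d t)
      + 3 * B * ∑ t ∈ Finset.Icc 1 n, d t := by
  induction n with
  | zero => simp
  | succ n ih =>
    have h1 := ih (fun t h h' => hdB t h (by omega)) (fun t h h' => hd t h (by omega))
    have hS : ∀ k, 0 ≤ ∑ t ∈ Finset.Icc 1 k, d t := fun k => Finset.sum_nonneg fun t _ => hd0 t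
    have hP : 0 ≤ ∑ t ∈ Finset.Icc 1 n, c t := Finset.sum_nonneg fun t _ => hc t
    have h2 := hd (n + 1) (by omega) le_rfl
    have h3 := hdB (n + 1) (by omega) le_rfl
    -- The two-step lag omits at most one term of the sum up to `n`, at cost `B`.
    have h4 : ∑ t ∈ Finset.Icc 1 n, d t ≤ (∑ t ∈ Finset.Icc 1 (n + 1 - 2), d t) + B := by
      rcases n with _ | n
      · simpa using hB
      · rw [Finset.sum_Icc_succ_top (by omega), show n + 1 + 1 - 2 = n by omega]
        linarith [hdB (n + 1) (by omega) (by omega)]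
    have h5 : ∑ t ∈ Finset.Icc 1 (n + 1 - 2), d t ≤ ∑ t ∈ Finset.Icc 1 n, d t :=
      Finset.sum_le_sum_of_subset_of_nonneg (Finset.Icc_subset_Icc_right (by omega))
        fun t _ _ => hd0 t
    rw [Finset.sum_Icc_succ_top (by omega), Finset.sum_Icc_succ_top (by omega)]
    have h0 := hS (n + 1 - 2)
    have hc1 := hc (n + 1)
    have hd1 := hd0 (n + 1)
    have hSn := hS n
    generalize (∑ t ∈ Finset.Icc 1 (n + 1 - 2), d t) = U at *
    generalize (∑ t ∈ Finset.Icc 1 n, d t) = V at *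
    generalize (∑ t ∈ Finset.Icc 1 n, c t) = P at *
    generalize d (n + 1) = e at *
    generalize c (n + 1) = k at *
    push_cast
    -- In `(V + e) ^ 2` the cross term `2 * e * V` is at most `2 * e * U + 2 * B * e`, and `e ^ 2 ≤
    -- B * e`; hence the coefficient `3 * B`.
    have e1 : e * V ≤ e * (U + B) := mul_le_mul_of_nonneg_left h4 hd1
    have e2 : e * e ≤ B * e := mul_le_mul_of_nonneg_right h3 hd1
    have e3 : G * k * (ε + U) ≤ G * k * (ε + V + e) :=
      mul_le_mul_of_nonneg_left (by linarith) (mul_nonneg hG hc1)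
    have e4 : 0 ≤ G * P * e := mul_nonneg (mul_nonneg hG hP) hd1
    have e5 : 0 ≤ e * ε := mul_nonneg hd1 hε
    nlinarith

/-- If the bound failed, then `R ≤ S`, so the right side of `h` would be at most `(A + B) * R * S`,
which is less than `S ^ 2`. -/
theorem le_mul_of_sq_le {S A B R : ℝ} (hA : 0 ≤ A) (hB : 0 ≤ B) (hR : 0 ≤ R)
    (h : S ^ 2 ≤ A * R ^ 2 + B * R * S) : S ≤ (A + B + 1) * R := by
  by_contra! hS
  have h1 : R ≤ S := by nlinarith [mul_nonneg (add_nonneg hA hB) hR]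
  have hS0 : 0 < S := lt_of_le_of_lt (by positivity) hS
  nlinarith [mul_lt_mul_of_pos_right hS hS0, mul_nonneg (mul_nonneg hA hR) (sub_nonneg.2 h1),
    mul_nonneg hR hS0.le]

end Sequences

/-! ### Proximal steps of a single player -/

section Player

variable {E : Type*} [NormedAddCommGroup E] [NormedSpace ℝ E]
  {φ : E → EReal} {X : Set E} {L D G : ℝ} {h : ℕ → E → ℝ} {η : ℕ → ℝ} {x u : ℕ → E}
  {p : ℕ → StrongDual ℝ E} {n : ℕ}

theorem CouplingLipschitzOn.mono {L' : ℝ} (hL : CouplingLipschitzOn L φ X) (h : L ≤ L') :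
    CouplingLipschitzOn L' φ X := fun α hα z hz a ha b hb =>
  (hL α hα z hz a ha b hb).trans <| by
    gcongr

/-- The constant in the Lipschitz condition is positive unless the set is a point. -/
theorem CouplingLipschitzOn.pos {a b : E} {z : StrongDual ℝ E} (hφ : IsProper φ)
    (hs : StronglyConvex 1 φ) (hL : CouplingLipschitzOn L φ X) (ha : a ∈ X) (hb : b ∈ X)
    (hz : z ∈ subdifferential φ a) (hab : b ≠ a) : 0 < L := by
  have h1 := hL.coupling_le hφ ha hz hb ha
  have h2 := hs.le_coupling hL hφ ha hz hb
  rw [coupling_self, zero_add] at h1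
  have h3 : 0 < ‖b - a‖ := norm_pos_iff.2 (sub_ne_zero.2 hab)
  by_contra! hneg
  nlinarith [mul_nonpos_of_nonpos_of_nonneg hneg h3.le, pow_pos h3 2]

/-- The dynamic regret of proximal steps, measured after each update. -/
theorem sum_prox_le (hφ : IsProper φ) (hs : StronglyConvex 1 φ) (hL : CouplingLipschitzOn L φ X)
    (hL0 : 0 ≤ L) (hD : ∀ a ∈ X, ∀ b ∈ X, ‖a - b‖ ≤ D)
    (hx : ∀ t, 1 ≤ t → t ≤ n + 1 → x t ∈ X) (hu : ∀ t, 1 ≤ t → t ≤ n + 1 → u t ∈ X)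
    (hp : ∀ t, 1 ≤ t → t ≤ n + 1 → p t ∈ subdifferential φ (x t))
    (hη : ∀ t, 0 < η t) (hη' : Antitone η)
    (hprox : ∀ t, 1 ≤ t → t ≤ n → ∀ c ∈ X,
      h t (x (t + 1)) - h t c ≤ 1 / η t * (p t - p (t + 1)) (x (t + 1) - c)) :
    ∑ t ∈ Finset.Icc 1 n, (h t (x (t + 1)) - h t (u (t + 1)))
      ≤ 1 / η n * (L * (D + ∑ t ∈ Finset.Icc 1 n, ‖u (t + 1) - u t‖)) := by
  have hw0 : ∀ t, 0 ≤ 1 / η t := fun t => (one_div_pos.2 (hη t)).le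
  have hpos : ∀ t, 1 ≤ t → t ≤ n + 1 → ∀ c ∈ X, 0 ≤ coupling φ (x t) (p t) c :=
    fun t h1 h2 c hc =>
      le_trans (by positivity) (hs.le_coupling hL hφ (hx t h1 h2) (hp t h1 h2) hc)
  have key := sum_weighted_sub_le (w := fun t => 1 / η t) (R := L * D) (L := L)
    (a := fun t => coupling φ (x t) (p t) (u (t + 1))) (b := fun t => coupling φ (x t) (p t) (u t))
    (c := fun t => ‖u (t + 1) - u t‖) hw0
    (fun s t hst => one_div_le_one_div_of_le (hη t) (hη' hst)) n
    -- The potential is bounded by `L * D` because the coupling vanishes at the current iterate.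
    (fun t h1 h2 => by
      have := hL.coupling_le hφ (hx t h1 h2) (hp t h1 h2) (hu t h1 h2) (hx t h1 h2)
      rw [coupling_self, zero_add] at this
      exact this.trans (mul_le_mul_of_nonneg_left (hD _ (hu t h1 h2) _ (hx t h1 h2)) hL0))
    (fun t => by positivity)
    (fun t h1 h2 => hL.coupling_le hφ (hx t h1 (by omega)) (hp t h1 (by omega))
      (hu (t + 1) (by omega) (by omega)) (hu t h1 (by omega)))
  have hlast := hpos (n + 1) (by omega) le_rfl _ (hu (n + 1) (by omega) le_rfl)
  refine (Finset.sum_le_sum fun t ht => ?_).trans (key.trans ?_)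
  · rw [Finset.mem_Icc] at ht
    refine (hprox t ht.1 ht.2 _ (hu (t + 1) (by omega) (by omega))).trans ?_
    refine mul_le_mul_of_nonneg_left ?_ (hw0 t)
    rw [coupling_three_point (φ := φ) (a := x t)]
    linarith [hpos t ht.1 (by omega) _ (hx (t + 1) (by omega) (by omega))]
  · exact mul_le_mul_of_nonneg_left (by linarith) (hw0 n)

/-- A proximal step moves by at most the step size times the Lipschitz constant. -/
theorem norm_prox_sub_le {k : E → ℝ} {γ : ℝ} {a a' : E} {z z' : StrongDual ℝ E} (hφ : IsProper φ)
    (hs : StronglyConvex 1 φ) (hL : CouplingLipschitzOn L φ X) (ha : a ∈ X) (ha' : a' ∈ X)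
    (hz : z ∈ subdifferential φ a) (hz' : z' ∈ subdifferential φ a') (hγ : 0 < γ)
    (hG : k a - k a' ≤ G * ‖a' - a‖)
    (hprox : k a' - k a ≤ 1 / γ * (z - z') (a' - a)) (hG0 : 0 ≤ G) : ‖a' - a‖ ≤ γ * G := by
  -- Both couplings between `a` and `a'` contribute half a square, so together they give `‖a' - a‖ ^
  -- 2 ≤ γ * G * ‖a' - a‖`.
  have h1 := hs.le_coupling hL hφ ha hz ha'
  have h2 := hs.le_coupling hL hφ ha' hz' ha
  rw [coupling_three_point (φ := φ) (a := a), coupling_self, one_div, inv_mul_eq_div,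
    le_div_iff₀ hγ] at hprox
  rw [norm_sub_rev a a'] at h2
  have h3 := mul_le_mul_of_nonneg_right hG hγ.le
  rcases (norm_nonneg (a' - a)).eq_or_lt with h0 | h0
  · rw [← h0]; positivity
  · nlinarith

end Player

/-! ### Payoffs and saddle-point updates -/

section Game

variable {E : Type*} [NormedAddCommGroup E] [NormedSpace ℝ E]
  {F : Type*} [NormedAddCommGroup F] [NormedSpace ℝ F]
  {X : Set E} {Y : Set F} {φ : E → EReal} {ψ : F → EReal} {f : ℕ → E → F → ℝ}
  {x x' : ℕ → E} {y y' : ℕ → F} {p : ℕ → StrongDual ℝ E} {q : ℕ → StrongDual ℝ F}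
  {η γ : ℕ → ℝ} {T n t : ℕ} {GX GY G L D C ε : ℝ}

/-- Pass through `(a', b)`, using the left subgradient at `(a, b)` and the right one at `(a', b')`.
Exchanging the two points gives the reverse bound, so the payoff is Lipschitz. -/
theorem IsPayoff.sub_le {g : E → F → ℝ} (hg : IsPayoff X Y GX GY g) (hGX : GX ≤ G) (hGY : GY ≤ G)
    {a a' : E} {b b' : F} (ha : a ∈ X) (ha' : a' ∈ X) (hb : b ∈ Y) (hb' : b' ∈ Y) :
    g a b - g a' b' ≤ G * ‖a - a'‖ + G * ‖b - b'‖ := by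
  obtain ⟨k, hk, hkn⟩ := hg.subgradient_left a ha b hb
  obtain ⟨l, hl, hln⟩ := hg.subgradient_right a' ha' b' hb'
  have h1 := hk a' ha'
  have h2 := hl b hb
  have h3 := (abs_le.1 (k.le_of_opNorm_le (hkn.trans hGX) (a' - a))).1
  have h4 := (abs_le.1 (l.le_of_opNorm_le (hln.trans hGY) (b - b'))).1
  rw [norm_sub_rev a' a] at h3
  dsimp only at h1 h2
  linarith

theorem IsPlay.left_mem_subdifferential (h : IsPlay f x y X Y φ ψ η γ p q T) (h1 : 1 ≤ t)
    (hT : t ≤ T) : p t ∈ subdifferential φ (x t) := by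
  obtain rfl | ⟨s, hs, rfl⟩ : t = 1 ∨ ∃ s, 1 ≤ s ∧ t = s + 1 := by
    rcases t with _ | _ | s
    · omega
    · simp
    · exact Or.inr ⟨s + 1, by omega, rfl⟩
  · exact h.init_left
  · exact (h.subgradient_left s hs (by omega)).1

theorem IsPlay.right_mem_subdifferential (h : IsPlay f x y X Y φ ψ η γ p q T) (h1 : 1 ≤ t)
    (hT : t ≤ T) : q t ∈ subdifferential ψ (y t) := by
  obtain rfl | ⟨s, hs, rfl⟩ : t = 1 ∨ ∃ s, 1 ≤ s ∧ t = s + 1 := by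
    rcases t with _ | _ | s
    · omega
    · simp
    · exact Or.inr ⟨s + 1, by omega, rfl⟩
  · exact h.init_right
  · exact (h.subgradient_right s hs (by omega)).1

theorem IsPlay.saddle_real {L' : ℝ} (h : IsPlay f x y X Y φ ψ η γ p q T) (hφ : IsProper φ)
    (hψ : IsProper ψ) (hLφ : CouplingLipschitzOn L φ X) (hLψ : CouplingLipschitzOn L' ψ Y)
    (h1 : 1 ≤ t) (hT : t < T) {a : E} {b : F} (ha : a ∈ X) (hb : b ∈ Y) :
    f t (x (t + 1)) b + 1 / η t * coupling φ (x t) (p t) (x (t + 1))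
        - 1 / γ t * coupling ψ (y t) (q t) b
      ≤ f t a (y (t + 1)) + 1 / η t * coupling φ (x t) (p t) a
        - 1 / γ t * coupling ψ (y t) (q t) (y (t + 1)) := by
  have hs := h.saddle t h1 hT a ha b hb
  have hx := h.mem_left t h1 hT.le
  have hy := h.mem_right t h1 hT.le
  have hp := h.left_mem_subdifferential h1 hT.le
  have hq := h.right_mem_subdifferential h1 hT.le
  rw [proxObjective, proxObjective, hLφ.fenchelCoupling_eq hφ hx hp ha,
    hLφ.fenchelCoupling_eq hφ hx hp (h.mem_left (t + 1) (by omega) hT),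
    hLψ.fenchelCoupling_eq hψ hy hq hb,
    hLψ.fenchelCoupling_eq hψ hy hq (h.mem_right (t + 1) (by omega) hT)] at hs
  exact_mod_cast hs

/-- Fixing the opponent at `y (t + 1)` cancels the `ψ` terms of the saddle inequality, so `x (t +
1)` solves an ordinary proximal problem. -/
theorem IsPlay.prox_left {L' : ℝ} (h : IsPlay f x y X Y φ ψ η γ p q T) (hX : Convex ℝ X)
    (hφ : IsProper φ) (hψ : IsProper ψ) (hLφ : CouplingLipschitzOn L φ X)
    (hLψ : CouplingLipschitzOn L' ψ Y) (hη : 0 < η t) (h1 : 1 ≤ t) (hT : t < T)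
    (hf : IsPayoff X Y GX GY (f t)) {c : E} (hc : c ∈ X) :
    f t (x (t + 1)) (y (t + 1)) - f t c (y (t + 1))
      ≤ 1 / η t * (p t - p (t + 1)) (x (t + 1) - c) := by
  have hy := h.mem_right (t + 1) (by omega) hT
  refine (h.subgradient_left t h1 hT).sub_le (a := x t) hX (hf.convexOn _ hy) hη
    (h.mem_left (t + 1) (by omega) hT) (fun a ha => ?_) hc
  linarith [h.saddle_real hφ hψ hLφ hLψ h1 hT ha hy]

theorem IsPlay.prox_right {L' : ℝ} (h : IsPlay f x y X Y φ ψ η γ p q T) (hY : Convex ℝ Y)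
    (hφ : IsProper φ) (hψ : IsProper ψ) (hLφ : CouplingLipschitzOn L φ X)
    (hLψ : CouplingLipschitzOn L' ψ Y) (hγ : 0 < γ t) (h1 : 1 ≤ t) (hT : t < T)
    (hf : IsPayoff X Y GX GY (f t)) {c : F} (hc : c ∈ Y) :
    -f t (x (t + 1)) (y (t + 1)) - -f t (x (t + 1)) c
      ≤ 1 / γ t * (q t - q (t + 1)) (y (t + 1) - c) := by
  have hx := h.mem_left (t + 1) (by omega) hT
  refine (h.subgradient_right t h1 hT).sub_le (a := y t) hY (hf.concaveOn _ hx).neg hγ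
    (h.mem_right (t + 1) (by omega) hT) (fun b hb => ?_) hc
  linarith [h.saddle_real hφ hψ hLφ hLψ h1 hT hx hb]

/-! ### Variability and the telescoping comparison -/

theorem abs_sub_le_rho {g k : E → F → ℝ} (hX : IsCompact X) (hY : IsCompact Y)
    (hg : ContinuousOn (Function.uncurry g) (X ×ˢ Y))
    (hk : ContinuousOn (Function.uncurry k) (X ×ˢ Y)) {a : E} {b : F} (ha : a ∈ X) (hb : b ∈ Y) :
    |g a b - k a b| ≤ rho X Y g k :=
  le_csSup ((hX.prod hY).image_of_continuousOn (hg.sub hk).abs).bddAbove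
    ⟨(a, b), ⟨ha, hb⟩, rfl⟩

theorem rho_nonneg (g k : E → F → ℝ) : 0 ≤ rho X Y g k := by
  refine Real.sSup_nonneg ?_
  rintro _ ⟨w, -, rfl⟩
  exact abs_nonneg _

theorem variability_nonneg (T : ℕ) : 0 ≤ variability f X Y T :=
  Finset.sum_nonneg fun _ _ => rho_nonneg _ _

/-- Pair `-H t (t + 1)` with the next diagonal term `H (t + 1) (t + 1)`: only the first index
changes, at cost `r (t + 1)`. The two unpaired end terms cost `M` each. -/
theorem sum_diag_sub_le {H : ℕ → ℕ → ℝ} {r : ℕ → ℝ} {M : ℝ} (hr : ∀ t, 0 ≤ r t) (hM : 0 ≤ M)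
    (n : ℕ) (hH : ∀ t, 1 ≤ t → t ≤ n → H (t + 1) (t + 1) - H t (t + 1) ≤ r (t + 1))
    (hfirst : 1 ≤ n → H 1 1 ≤ M) (hlast : 1 ≤ n → -H n (n + 1) ≤ M) :
    ∑ t ∈ Finset.Icc 1 n, (H t t - H t (t + 1)) ≤ 2 * M + ∑ t ∈ Finset.Icc 1 n, r t := by
  rcases Nat.eq_zero_or_pos n with rfl | hn
  · simpa using hM
  · have key : ∀ k, 1 ≤ k → k ≤ n → ∑ t ∈ Finset.Icc 1 k, (H t t - H t (t + 1))
        ≤ M + ∑ t ∈ Finset.Icc 1 k, r t - H k (k + 1) := by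
      intro k hk
      induction k, hk using Nat.le_induction with
      | base => intro _; simp; linarith [hfirst hn, hr 1]
      | succ k hk ih =>
        intro hkn
        rw [Finset.sum_Icc_succ_top (by omega), Finset.sum_Icc_succ_top (by omega)]
        linarith [ih (by omega), hH k hk (by omega)]
    linarith [key n hn le_rfl, hlast hn]

/-! ### The quantities `Σ_t` and `Δ_t`, and the learning rate -/

theorem sigma_nonneg (t : ℕ) : 0 ≤ sigma f x x' y y' t :=
  (le_max_right _ _).trans (le_max_left _ _)

theorem delta_nonneg (t : ℕ) : 0 ≤ delta f x x' y y' t := le_max_right _ _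

theorem sum_delta (n : ℕ) : ∑ t ∈ Finset.Icc 1 n, delta f x x' y y' t
    = sSup (sigma f x x' y y' '' Set.Ico 1 (n + 1)) :=
  sum_max_sub_sSup sigma_nonneg n

theorem sum_delta_mono : Monotone fun n => ∑ t ∈ Finset.Icc 1 n, delta f x x' y y' t :=
  fun _ _ h => Finset.sum_le_sum_of_subset_of_nonneg (Finset.Icc_subset_Icc_right h)
    fun t _ _ => delta_nonneg t

theorem sigma_le_sSup (h1 : 1 ≤ t) (ht : t < n) :
    sigma f x x' y y' t ≤ sSup (sigma f x x' y y' '' Set.Ico 1 n) :=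
  le_csSup ((Set.finite_Ico _ _).image _).bddAbove ⟨t, ⟨h1, ht⟩, rfl⟩

theorem sigma_zero : sigma f x x' y y' 0 = 0 := by simp [sigma, sigma₁, sigma₂]

theorem sigma_le_sum_delta (n : ℕ) :
    sigma f x x' y y' n ≤ ∑ t ∈ Finset.Icc 1 n, delta f x x' y y' t := by
  rw [sum_delta]
  rcases Nat.eq_zero_or_pos n with rfl | hn
  · simp [sigma_zero]
  · exact sigma_le_sSup hn n.lt_succ_self

/-- The past maximum is at least `Σ_{t-1}`, so `Δ_t` is controlled by a single summand of the two
sums. -/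
theorem delta_le {c : ℝ} (hc : 0 ≤ c) (ht : 1 ≤ t)
    (h₁ : f t (x t) (y t) - f t (x (t + 1)) (y (t + 1))
      + f t (x' (t + 1)) (y (t + 1)) - f t (x' t) (y t) ≤ c)
    (h₂ : f t (x t) (y' t) - f t (x (t + 1)) (y' (t + 1))
      + f t (x (t + 1)) (y (t + 1)) - f t (x t) (y t) ≤ c) :
    delta f x x' y y' t ≤ c := by
  obtain ⟨s, rfl⟩ : ∃ s, t = s + 1 := ⟨t - 1, by omega⟩
  have h3 : sigma f x x' y y' s ≤ sSup (sigma f x x' y y' '' Set.Ico 1 (s + 1)) := by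
    rw [← sum_delta]; exact sigma_le_sum_delta s
  have h4 : sigma f x x' y y' (s + 1) ≤ sigma f x x' y y' s + c := by
    have h5 : sigma₁ f x x' y s ≤ sigma f x x' y y' s := le_max_left _ _
    have h6 : sigma₂ f x y y' s ≤ sigma f x x' y y' s := le_max_right _ _
    have h0 := sigma_nonneg (f := f) (x := x) (x' := x') (y := y) (y' := y') s
    refine max_le (max_le ?_ (by linarith)) (max_le ?_ (by linarith)) <;>
      rw [Finset.sum_Icc_succ_top (by omega)]
    · linarith [(le_max_left _ _).trans h5]
    · linarith [(le_max_left _ _).trans h6]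
  exact max_le (by linarith) hc

theorem sum_norm_le_pathLength (hn : n + 1 ≤ T) :
    ∑ t ∈ Finset.Icc 1 n, (‖x' (t + 1) - x' t‖ + ‖y' (t + 1) - y' t‖) ≤ pathLength x' y' T := by
  have h : ∑ t ∈ Finset.Icc 1 n, (‖x' (t + 1) - x' t‖ + ‖y' (t + 1) - y' t‖)
      ≤ pathLength x' y' (n + 1) := by
    induction n with
    | zero => simp [pathLength]; positivity
    | succ n ih =>
      rw [Finset.sum_Icc_succ_top (by omega), pathLength, Finset.sum_Icc_succ_top (by omega)]
      exact add_le_add (ih (by omega)) le_rfl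
  exact h.trans (Finset.sum_le_sum_of_subset_of_nonneg (Finset.Icc_subset_Icc_right hn)
    fun t _ _ => by positivity)

theorem pathLength_nonneg (T : ℕ) : 0 ≤ pathLength x' y' T :=
  Finset.sum_nonneg fun _ _ => by positivity

theorem sum_delta_nonneg (n : ℕ) : 0 ≤ ∑ t ∈ Finset.Icc 1 n, delta f x x' y y' t :=
  Finset.sum_nonneg fun t _ => delta_nonneg t

theorem rate_pos (hLC : 0 < L * (2 * D + C)) (hε : 0 < ε) (t : ℕ) :
    0 < rate f x x' y y' L D C ε t :=
  div_pos hLC (add_pos_of_pos_of_nonneg hε (sum_delta_nonneg _))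

theorem rate_antitone (hLC : 0 < L * (2 * D + C)) (hε : 0 < ε) :
    Antitone (rate f x x' y y' L D C ε) := fun _ _ hst =>
  div_le_div_of_nonneg_left hLC.le (add_pos_of_pos_of_nonneg hε (sum_delta_nonneg _))
    (add_le_add_right (sum_delta_mono (Nat.sub_le_sub_right hst 2)) ε)

/-- The numerator of the rate cancels the potential bound and leaves `ε` plus the delayed sum, which
is then enlarged to the full one. -/
theorem one_div_rate_mul_le (hLC : 0 < L * (2 * D + C)) (hε : 0 < ε) {P : ℝ}
    (hP : P ≤ L * (2 * D + C)) (n : ℕ) :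
    1 / rate f x x' y y' L D C ε n * P ≤ ε + ∑ t ∈ Finset.Icc 1 n, delta f x x' y y' t := by
  calc 1 / rate f x x' y y' L D C ε n * P
      ≤ 1 / rate f x x' y y' L D C ε n * (L * (2 * D + C)) :=
        mul_le_mul_of_nonneg_left hP (one_div_pos.2 (rate_pos hLC hε n)).le
    _ = ε + ∑ t ∈ Finset.Icc 1 (n - 2), delta f x x' y y' t := by
        rw [rate, one_div_div, div_mul_cancel₀ _ hLC.ne']
    _ ≤ _ := add_le_add_right (sum_delta_mono (Nat.sub_le n 2)) ε


/-! ### Two bounds for `∑ Δ`, and the regret decomposition -/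

/-- The sum of the `Δ_t` is bounded by the variability of the payoff functions. -/
theorem sum_delta_le_variability (hX : IsCompact X) (hY : IsCompact Y)
    (hDX : ∀ a ∈ X, ∀ b ∈ X, ‖a - b‖ ≤ D) (hDY : ∀ a ∈ Y, ∀ b ∈ Y, ‖a - b‖ ≤ D)
    (hGX : GX ≤ G) (hGY : GY ≤ G) (hG : 0 ≤ G) (hD : 0 ≤ D)
    (hf : ∀ t, 1 ≤ t → t ≤ n + 1 → IsPayoff X Y GX GY (f t))
    (hx : ∀ t, 1 ≤ t → t ≤ n + 1 → x t ∈ X) (hy : ∀ t, 1 ≤ t → t ≤ n + 1 → y t ∈ Y)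
    (hbr : IsBestResponse f x x' y y' X Y (n + 1)) :
    ∑ t ∈ Finset.Icc 1 n, delta f x x' y y' t
      ≤ 2 * (G * D) + 2 * variability f X Y (n + 1) := by
  have hV := variability_nonneg (X := X) (Y := Y) (f := f) (n + 1)
  have hGD := mul_nonneg hG hD
  have hlipX : ∀ t, 1 ≤ t → t ≤ n + 1 → ∀ a ∈ X, ∀ a' ∈ X, ∀ b ∈ Y,
      f t a b - f t a' b ≤ G * D := fun t h1 h2 a ha a' ha' b hb => by
    have := (hf t h1 h2).sub_le hGX hGY ha ha' hb hb
    rw [sub_self, norm_zero, mul_zero, add_zero] at this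
    exact this.trans (mul_le_mul_of_nonneg_left (hDX _ ha _ ha') hG)
  have hlipY : ∀ t, 1 ≤ t → t ≤ n + 1 → ∀ a ∈ X, ∀ b ∈ Y, ∀ b' ∈ Y,
      f t a b - f t a b' ≤ G * D := fun t h1 h2 a ha b hb b' hb' => by
    have := (hf t h1 h2).sub_le hGX hGY ha ha hb hb'
    rw [sub_self, norm_zero, mul_zero, zero_add] at this
    exact this.trans (mul_le_mul_of_nonneg_left (hDY _ hb _ hb') hG)
  have hrho : ∀ t, 1 ≤ t → t ≤ n → ∀ a ∈ X, ∀ b ∈ Y,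
      |f (t + 1) a b - f t a b| ≤ rho X Y (f (t + 1)) (f t) := fun t h1 h2 a ha b hb =>
    abs_sub_le_rho hX hY (hf (t + 1) (by omega) (by omega)).continuousOn
      (hf t h1 (by omega)).continuousOn ha hb
  have hx' : ∀ t, t ≤ n + 1 → x' t ∈ X := hbr.mem_left
  have hy' : ∀ t, t ≤ n + 1 → y' t ∈ Y := hbr.mem_right
  have hVk : ∀ k, k ≤ n → ∑ t ∈ Finset.Icc 1 k, 2 * rho X Y (f t) (f (t - 1))
      ≤ 2 * variability f X Y (n + 1) := fun k hk => by
    rw [variability, Finset.mul_sum]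
    exact Finset.sum_le_sum_of_subset_of_nonneg (Finset.Icc_subset_Icc_right (by omega))
      fun t _ _ => mul_nonneg zero_le_two (rho_nonneg _ _)
  have hsig : ∀ k, k ≤ n → sigma f x x' y y' k ≤ 2 * (G * D) + 2 * variability f X Y (n + 1) := by
    intro k hk
    refine max_le (max_le ?_ (by positivity)) (max_le ?_ (by positivity))
    -- `H t s` is Player 1's gap under `f t` at the points of time `s`. Changing only the payoff
    -- alters two evaluations, whence `2 * rho`.
    · refine le_trans (le_of_eq (Finset.sum_congr rfl fun t _ => ?_)) ((sum_diag_sub_le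
        (H := fun t s => f t (x s) (y s) - f t (x' s) (y s))
        (r := fun t => 2 * rho X Y (f t) (f (t - 1))) (M := G * D)
        (fun t => mul_nonneg zero_le_two (rho_nonneg _ _)) hGD k ?_ ?_ ?_).trans ?_)
      · ring
      · intro t h1 h2
        have e1 := abs_le.1 (hrho t h1 (by omega) _ (hx (t + 1) (by omega) (by omega)) _
          (hy (t + 1) (by omega) (by omega)))
        have e2 := abs_le.1 (hrho t h1 (by omega) _ (hx' (t + 1) (by omega)) _
          (hy (t + 1) (by omega) (by omega)))
        simp only [Nat.add_sub_cancel]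
        linarith [e1.2, e2.1]
      · exact fun _ => hlipX 1 le_rfl (by omega) _ (hx 1 le_rfl (by omega)) _ (hx' 1 (by omega)) _
          (hy 1 le_rfl (by omega))
      · intro h1
        rw [neg_sub]
        exact hlipX k h1 (by omega) _ (hx' (k + 1) (by omega)) _ (hx (k + 1) (by omega) (by omega))
          _ (hy (k + 1) (by omega) (by omega))
      · linarith [hVk k hk]
    · refine le_trans (le_of_eq (Finset.sum_congr rfl fun t _ => ?_)) ((sum_diag_sub_le
        (H := fun t s => f t (x s) (y' s) - f t (x s) (y s))
        (r := fun t => 2 * rho X Y (f t) (f (t - 1))) (M := G * D)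
        (fun t => mul_nonneg zero_le_two (rho_nonneg _ _)) hGD k ?_ ?_ ?_).trans ?_)
      · ring
      · intro t h1 h2
        have e1 := abs_le.1 (hrho t h1 (by omega) _ (hx (t + 1) (by omega) (by omega)) _
          (hy (t + 1) (by omega) (by omega)))
        have e2 := abs_le.1 (hrho t h1 (by omega) _ (hx (t + 1) (by omega) (by omega)) _
          (hy' (t + 1) (by omega)))
        simp only [Nat.add_sub_cancel]
        linarith [e1.1, e2.2]
      · exact fun _ => hlipY 1 le_rfl (by omega) _ (hx 1 le_rfl (by omega)) _ (hy' 1 (by omega)) _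
          (hy 1 le_rfl (by omega))
      · intro h1
        rw [neg_sub]
        exact hlipY k h1 (by omega) _ (hx (k + 1) (by omega) (by omega)) _
          (hy (k + 1) (by omega) (by omega)) _ (hy' (k + 1) (by omega))
      · linarith [hVk k hk]
  rw [sum_delta]
  refine Real.sSup_le ?_ (by positivity)
  rintro _ ⟨k, hk, rfl⟩
  exact hsig k (Nat.lt_succ_iff.1 hk.2)

/-- The sum of the `Δ_t` is bounded by a multiple of `√((1 + C) T)`. -/
theorem sum_delta_le_sqrt (hX : Convex ℝ X) (hY : Convex ℝ Y)
    (hDX : ∀ a ∈ X, ∀ b ∈ X, ‖a - b‖ ≤ D) (hDY : ∀ a ∈ Y, ∀ b ∈ Y, ‖a - b‖ ≤ D)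
    (hGX : GX ≤ G) (hGY : GY ≤ G) (hG : 0 ≤ G) (hD : 0 < D) (hL : 0 < L) (hε : 0 < ε)
    (hf : ∀ t, 1 ≤ t → t ≤ n + 1 → IsPayoff X Y GX GY (f t))
    (hφ : IsProper φ) (hsφ : StronglyConvex 1 φ) (hLφ : CouplingLipschitzOn L φ X)
    (hψ : IsProper ψ) (hsψ : StronglyConvex 1 ψ) (hLψ : CouplingLipschitzOn L ψ Y)
    (hbr : IsBestResponse f x x' y y' X Y (n + 1)) (hC : pathLength x' y' (n + 1) ≤ C)
    (hplay : IsPlay f x y X Y φ ψ (rate f x x' y y' L D C ε) (rate f x x' y y' L D C ε) p q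
      (n + 1)) :
    ∑ t ∈ Finset.Icc 1 n, delta f x x' y y' t
      ≤ (6 * G ^ 2 * L * (2 * D + 1) + 2 * G * (2 * D + 1) * ε
          + (2 * G * (2 * D + 1) + 12 * (G * D)) + 1) * √((1 + C) * (n + 1 : ℕ)) := by
  have hC0 : 0 ≤ C := (pathLength_nonneg _).trans hC
  have hLC : 0 < L * (2 * D + C) := by positivity
  have hη := rate_pos (f := f) (x := x) (x' := x') (y := y) (y' := y') hLC hε
  have hx := hplay.mem_left
  have hy := hplay.mem_right
  have hx' := hbr.mem_left
  have hy' := hbr.mem_right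
  set c : ℕ → ℝ := fun t => ‖x' (t + 1) - x' t‖ + ‖y' (t + 1) - y' t‖ with hc
  have hc0 : ∀ t, 0 ≤ c t := fun t => by positivity
  have hcD : ∀ t, t ≤ n → c t ≤ 2 * D := fun t ht => by
    have e1 := hDX _ (hx' (t + 1) (by omega)) _ (hx' t (by omega))
    have e2 := hDY _ (hy' (t + 1) (by omega)) _ (hy' t (by omega))
    simp only [hc]; linarith
  have hmoveX : ∀ t, 1 ≤ t → t ≤ n → ‖x (t + 1) - x t‖ ≤ rate f x x' y y' L D C ε t * G := by
    intro t h1 h2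
    have e := (hf t h1 (by omega)).sub_le hGX hGY (hx t h1 (by omega))
      (hx (t + 1) (by omega) (by omega)) (hy (t + 1) (by omega) (by omega))
      (hy (t + 1) (by omega) (by omega))
    rw [sub_self, norm_zero, mul_zero, add_zero, norm_sub_rev] at e
    exact norm_prox_sub_le (k := fun a => f t a (y (t + 1))) hφ hsφ hLφ (hx t h1 (by omega))
      (hx (t + 1) (by omega) (by omega)) (hplay.left_mem_subdifferential h1 (by omega))
      (hplay.left_mem_subdifferential (by omega) (by omega)) (hη t) e
      (hplay.prox_left hX hφ hψ hLφ hLψ (hη t) h1 (by omega) (hf t h1 (by omega))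
        (hx t h1 (by omega))) hG
  have hmoveY : ∀ t, 1 ≤ t → t ≤ n → ‖y (t + 1) - y t‖ ≤ rate f x x' y y' L D C ε t * G := by
    intro t h1 h2
    have e := (hf t h1 (by omega)).sub_le hGX hGY (hx (t + 1) (by omega) (by omega))
      (hx (t + 1) (by omega) (by omega)) (hy (t + 1) (by omega) (by omega)) (hy t h1 (by omega))
    rw [sub_self, norm_zero, mul_zero, zero_add] at e
    refine norm_prox_sub_le (k := fun b => -f t (x (t + 1)) b) hψ hsψ hLψ (hy t h1 (by omega))
      (hy (t + 1) (by omega) (by omega)) (hplay.right_mem_subdifferential h1 (by omega))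
      (hplay.right_mem_subdifferential (by omega) (by omega)) (hη t) ?_
      (hplay.prox_right hY hφ hψ hLφ hLψ (hη t) h1 (by omega) (hf t h1 (by omega))
        (hy t h1 (by omega))) hG
    linarith
  -- Both one-step increments are controlled by the lengths of the four moves.
  have hdelta : ∀ t, 1 ≤ t → t ≤ n → ∀ m, ‖x (t + 1) - x t‖ ≤ m → ‖y (t + 1) - y t‖ ≤ m →
      ∀ k, ‖x' (t + 1) - x' t‖ ≤ k → ‖y' (t + 1) - y' t‖ ≤ k →
      delta f x x' y y' t ≤ 3 * (G * m) + G * k := by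
    intro t h1 h2 m hmx hmy k hkx hky
    have hft := hf t h1 (by omega)
    have hm0 := (norm_nonneg _).trans hmx
    have hk0 := (norm_nonneg _).trans hkx
    have xt := hx t h1 (by omega)
    have xs := hx (t + 1) (by omega) (by omega)
    have yt := hy t h1 (by omega)
    have ys := hy (t + 1) (by omega) (by omega)
    have xt' := hx' t (by omega)
    have xs' := hx' (t + 1) (by omega)
    have yt' := hy' t (by omega)
    have ys' := hy' (t + 1) (by omega)
    have g1 := mul_le_mul_of_nonneg_left hmx hG
    have g2 := mul_le_mul_of_nonneg_left hmy hG
    have g3 := mul_le_mul_of_nonneg_left hkx hG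
    have g4 := mul_le_mul_of_nonneg_left hky hG
    have e1 := hft.sub_le hGX hGY xt xs yt ys
    have e2 := hft.sub_le hGX hGY xs' xt' ys yt
    have e3 := hft.sub_le hGX hGY xt xs yt' ys'
    have e4 := hft.sub_le hGX hGY xs xt ys yt
    rw [norm_sub_rev (x t), norm_sub_rev (y t)] at e1
    rw [norm_sub_rev (x t), norm_sub_rev (y' t)] at e3
    exact delta_le (by positivity) h1 (by linarith) (by linarith)
  -- `B` comes from bounding all moves by `D`; `A` comes from moves of length `η t * G`, since `η t`
  -- times its denominator is `L * (2 * D + C)`.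
  have hkey := sum_sq_le_of_mul_le (d := delta f x x' y y') (c := c) (ε := ε)
    (A := 3 * G ^ 2 * (L * (2 * D + C))) (B := 4 * (G * D)) hε.le hG delta_nonneg hc0 n
    (by positivity)
    (fun t h1 h2 => (hdelta t h1 h2 D
      (hDX _ (hx (t + 1) (by omega) (by omega)) _ (hx t h1 (by omega)))
      (hDY _ (hy (t + 1) (by omega) (by omega)) _ (hy t h1 (by omega))) D
      (hDX _ (hx' (t + 1) (by omega)) _ (hx' t (by omega)))
      (hDY _ (hy' (t + 1) (by omega)) _ (hy' t (by omega)))).trans (by linarith))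
    (fun t h1 h2 => by
      have e := hdelta t h1 h2 _ (hmoveX t h1 h2) (hmoveY t h1 h2) (c t)
        (le_add_of_nonneg_right (norm_nonneg _)) (le_add_of_nonneg_left (norm_nonneg _))
      have hpos : 0 < ε + ∑ τ ∈ Finset.Icc 1 (t - 2), delta f x x' y y' τ :=
        add_pos_of_pos_of_nonneg hε (sum_delta_nonneg _)
      have hr : rate f x x' y y' L D C ε t * (ε + ∑ τ ∈ Finset.Icc 1 (t - 2), delta f x x' y y' τ)
          = L * (2 * D + C) := div_mul_cancel₀ _ hpos.ne'
      refine (mul_le_mul_of_nonneg_right e hpos.le).trans (le_of_eq ?_)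
      rw [← hr]; ring)
  have hS := sum_delta_nonneg (f := f) (x := x) (x' := x') (y := y) (y' := y') n
  have hPC : ∑ t ∈ Finset.Icc 1 n, c t ≤ C := (sum_norm_le_pathLength le_rfl).trans hC
  have hP0 : 0 ≤ ∑ t ∈ Finset.Icc 1 n, c t := Finset.sum_nonneg fun t _ => hc0 t
  have hPD : ∑ t ∈ Finset.Icc 1 n, c t ≤ 2 * D * n := by
    refine (Finset.sum_le_sum fun t ht => hcD t (Finset.mem_Icc.1 ht).2).trans (le_of_eq ?_)
    simp [mul_comm]
  have hR2 : √((1 + C) * (n + 1 : ℕ)) ^ 2 = (1 + C) * (n + 1) := by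
    rw [Real.sq_sqrt (by positivity)]; push_cast; ring
  have hR0 : 0 ≤ √((1 + C) * (n + 1 : ℕ)) := Real.sqrt_nonneg _
  generalize √((1 + C) * (n + 1 : ℕ)) = R at *
  generalize ∑ t ∈ Finset.Icc 1 n, delta f x x' y y' t = S at *
  generalize ∑ t ∈ Finset.Icc 1 n, c t = P at *
  have hn0 : (0 : ℝ) ≤ n := n.cast_nonneg
  have hR1 : 1 ≤ R := by
    rw [← one_le_sq_iff₀ hR0, hR2]
    nlinarith [mul_nonneg hC0 hn0]
  -- Multiplying the bounds `P ≤ C` and `P ≤ 2 * D * n` puts `P` on the scale of `R`.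
  have hPR : P ≤ (2 * D + 1) * R := by
    refine le_of_sq_le_sq ?_ (by positivity)
    rw [mul_pow, hR2]
    calc P ^ 2 = P * P := sq P
      _ ≤ C * (2 * D * n) := mul_le_mul hPC hPD hP0 hC0
      _ ≤ (1 + C) * ((2 * D + 1) ^ 2 * (n + 1)) := by
        refine mul_le_mul (by linarith) ?_ (by positivity) (by positivity)
        exact mul_le_mul (by nlinarith) (by linarith) hn0 (by positivity)
      _ = _ := by ring
  have hAR : (2 * D + C) * n ≤ (2 * D + 1) * R ^ 2 := by
    rw [hR2, ← mul_assoc]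
    refine mul_le_mul ?_ (by linarith) hn0 (by positivity)
    nlinarith [mul_nonneg hD.le hC0]
  refine le_mul_of_sq_le (by positivity) (by positivity) hR0 (hkey.trans ?_)
  have t1 := mul_le_mul_of_nonneg_left hAR (by positivity : 0 ≤ 6 * G ^ 2 * L)
  have t2 : G * P * (ε + S) ≤ G * ((2 * D + 1) * R) * (ε * R + S) := by
    refine mul_le_mul (mul_le_mul_of_nonneg_left hPR hG) ?_ (by positivity) (by positivity)
    nlinarith
  have t3 : G * D * S * 1 ≤ G * D * S * R := mul_le_mul_of_nonneg_left hR1 (by positivity)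
  linarith

/-- Both regrets are bounded in terms of the sum of the `Δ_t`. -/
theorem regret_le_sum_delta (hX : Convex ℝ X) (hY : Convex ℝ Y)
    (hDX : ∀ a ∈ X, ∀ b ∈ X, ‖a - b‖ ≤ D) (hDY : ∀ a ∈ Y, ∀ b ∈ Y, ‖a - b‖ ≤ D)
    (hGX : GX ≤ G) (hGY : GY ≤ G) (hG : 0 ≤ G) (hD : 0 < D) (hL : 0 < L) (hε : 0 < ε)
    (hf : ∀ t, 1 ≤ t → t ≤ n + 1 → IsPayoff X Y GX GY (f t))
    (hφ : IsProper φ) (hsφ : StronglyConvex 1 φ) (hLφ : CouplingLipschitzOn L φ X)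
    (hψ : IsProper ψ) (hsψ : StronglyConvex 1 ψ) (hLψ : CouplingLipschitzOn L ψ Y)
    (hbr : IsBestResponse f x x' y y' X Y (n + 1)) (hC : pathLength x' y' (n + 1) ≤ C)
    (hplay : IsPlay f x y X Y φ ψ (rate f x x' y y' L D C ε) (rate f x x' y y' L D C ε) p q
      (n + 1)) :
    regret₁ f x x' y (n + 1)
        ≤ ε + G * D + 2 * ∑ t ∈ Finset.Icc 1 n, delta f x x' y y' t ∧
      regret₂ f x y y' (n + 1)
        ≤ ε + G * D + 2 * ∑ t ∈ Finset.Icc 1 n, delta f x x' y y' t := by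
  have hC0 : 0 ≤ C := (pathLength_nonneg _).trans hC
  have hLC : 0 < L * (2 * D + C) := by positivity
  have hη := rate_pos (f := f) (x := x) (x' := x') (y := y) (y' := y') hLC hε
  have hη' := rate_antitone (f := f) (x := x) (x' := x') (y := y) (y' := y') hLC hε
  have hPC := (sum_norm_le_pathLength (x' := x') (y' := y') (n := n) le_rfl).trans hC
  have hPx : ∑ t ∈ Finset.Icc 1 n, ‖x' (t + 1) - x' t‖ ≤ C :=
    (Finset.sum_le_sum fun t _ => le_add_of_nonneg_right (norm_nonneg _)).trans hPC
  have hPy : ∑ t ∈ Finset.Icc 1 n, ‖y' (t + 1) - y' t‖ ≤ C :=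
    (Finset.sum_le_sum fun t _ => le_add_of_nonneg_left (norm_nonneg _)).trans hPC
  have hσ := sigma_le_sum_delta (f := f) (x := x) (x' := x') (y := y) (y' := y') n
  have hσ₁ := ((le_max_left _ _).trans (le_max_left _ _)).trans hσ
  have hσ₂ := ((le_max_left _ _).trans (le_max_right _ _)).trans hσ
  have hfl := hf (n + 1) (by omega) le_rfl
  have hxl := hplay.mem_left (n + 1) (by omega) le_rfl
  have hyl := hplay.mem_right (n + 1) (by omega) le_rfl
  constructor
  · have hprox := (sum_prox_le (h := fun t a => f t a (y (t + 1))) (u := x') hφ hsφ hLφ hL.le hDX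
      hplay.mem_left (fun t _ h2 => hbr.mem_left t h2)
      (fun t h1 h2 => hplay.left_mem_subdifferential h1 h2) hη hη'
      (fun t h1 h2 c hc => hplay.prox_left hX hφ hψ hLφ hLψ (hη t) h1 (by omega)
        (hf t h1 (by omega)) hc)).trans
      (one_div_rate_mul_le hLC hε (mul_le_mul_of_nonneg_left (by linarith) hL.le) n)
    have hlast := hfl.sub_le hGX hGY hxl (hbr.mem_left (n + 1) le_rfl) hyl hyl
    rw [sub_self, norm_zero, mul_zero, add_zero] at hlast
    have hlast' := hlast.trans
      (mul_le_mul_of_nonneg_left (hDX _ hxl _ (hbr.mem_left (n + 1) le_rfl)) hG)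
    -- The last round is kept apart, since no update follows it.
    have hsplit : regret₁ f x x' y (n + 1) = (∑ t ∈ Finset.Icc 1 n,
        (f t (x t) (y t) - f t (x (t + 1)) (y (t + 1))
          + f t (x' (t + 1)) (y (t + 1)) - f t (x' t) (y t)))
        + ∑ t ∈ Finset.Icc 1 n, (f t (x (t + 1)) (y (t + 1)) - f t (x' (t + 1)) (y (t + 1)))
        + (f (n + 1) (x (n + 1)) (y (n + 1)) - f (n + 1) (x' (n + 1)) (y (n + 1))) := by
      rw [regret₁, ← Finset.sum_sub_distrib, Finset.sum_Icc_succ_top (by omega),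
        ← Finset.sum_add_distrib]
      congr 1
      exact Finset.sum_congr rfl fun t _ => by ring
    rw [hsplit]
    linarith
  · have hprox := (sum_prox_le (h := fun t b => -f t (x (t + 1)) b) (u := y') hψ hsψ hLψ hL.le hDY
      hplay.mem_right (fun t _ h2 => hbr.mem_right t h2)
      (fun t h1 h2 => hplay.right_mem_subdifferential h1 h2) hη hη'
      (fun t h1 h2 c hc => hplay.prox_right hY hφ hψ hLφ hLψ (hη t) h1 (by omega)
        (hf t h1 (by omega)) hc)).trans
      (one_div_rate_mul_le hLC hε (mul_le_mul_of_nonneg_left (by linarith) hL.le) n)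
    have hlast := hfl.sub_le hGX hGY hxl hxl (hbr.mem_right (n + 1) le_rfl) hyl
    rw [sub_self, norm_zero, mul_zero, zero_add] at hlast
    have hlast' := hlast.trans
      (mul_le_mul_of_nonneg_left (hDY _ (hbr.mem_right (n + 1) le_rfl) _ hyl) hG)
    have hsplit : regret₂ f x y y' (n + 1) = (∑ t ∈ Finset.Icc 1 n,
        (f t (x t) (y' t) - f t (x (t + 1)) (y' (t + 1))
          + f t (x (t + 1)) (y (t + 1)) - f t (x t) (y t)))
        + ∑ t ∈ Finset.Icc 1 n, (-f t (x (t + 1)) (y (t + 1)) - -f t (x (t + 1)) (y' (t + 1)))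
        + (f (n + 1) (x (n + 1)) (y' (n + 1)) - f (n + 1) (x (n + 1)) (y (n + 1))) := by
      rw [regret₂, ← Finset.sum_sub_distrib, Finset.sum_Icc_succ_top (by omega),
        ← Finset.sum_add_distrib]
      congr 1
      exact Finset.sum_congr rfl fun t _ => by ring
    rw [hsplit]
    linarith

/-- If both strategy sets are points, there is no regret. -/
theorem regret_nonpos (hDX : ∀ a ∈ X, ∀ b ∈ X, ‖a - b‖ ≤ 0) (hDY : ∀ a ∈ Y, ∀ b ∈ Y, ‖a - b‖ ≤ 0)
    (hx : ∀ t, 1 ≤ t → t ≤ T → x t ∈ X) (hy : ∀ t, 1 ≤ t → t ≤ T → y t ∈ Y)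
    (hbr : IsBestResponse f x x' y y' X Y T) :
    regret₁ f x x' y T ≤ 0 ∧ regret₂ f x y y' T ≤ 0 := by
  have hX : ∀ a ∈ X, ∀ b ∈ X, a = b := fun a ha b hb =>
    sub_eq_zero.1 (norm_le_zero_iff.1 (hDX a ha b hb))
  have hY : ∀ a ∈ Y, ∀ b ∈ Y, a = b := fun a ha b hb =>
    sub_eq_zero.1 (norm_le_zero_iff.1 (hDY a ha b hb))
  constructor
  · refine sub_nonpos.2 (le_of_eq (Finset.sum_congr rfl fun t ht => ?_))
    rw [Finset.mem_Icc] at ht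
    rw [hX _ (hx t ht.1 ht.2) _ (hbr.mem_left t ht.2)]
  · refine sub_nonpos.2 (le_of_eq (Finset.sum_congr rfl fun t ht => ?_))
    rw [Finset.mem_Icc] at ht
    rw [hY _ (hy t ht.1 ht.2) _ (hbr.mem_right t ht.2)]

end Game

end OPPM

/-! ### The uniform constant and degenerate cases -/

theorem mainTheorem4 (DX DY GX GY Lφ Lψ ε : ℝ) (hε : 0 < ε) :
    ∃ K : ℝ, 0 < K ∧
      ∀ (E : Type u) (F : Type v) [NormedAddCommGroup E] [NormedSpace ℝ E]
        [NormedAddCommGroup F] [NormedSpace ℝ F]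
        (X : Set E) (Y : Set F) (φ : E → EReal) (ψ : F → EReal)
        (T : ℕ) (C : ℝ) (f : ℕ → E → F → ℝ)
        (x x' : ℕ → E) (y y' : ℕ → F)
        (p : ℕ → StrongDual ℝ E) (q : ℕ → StrongDual ℝ F),
        IsCompact X → Convex ℝ X → Metric.diam X = DX →
        IsCompact Y → Convex ℝ Y → Metric.diam Y = DY →
        (∀ t, 1 ≤ t → t ≤ T → OPPM.IsPayoff X Y GX GY (f t)) →
        ContinuousOn (Function.uncurry (f 0)) (X ×ˢ Y) →
        OPPM.IsProper φ → OPPM.StronglyConvex 1 φ → OPPM.CouplingLipschitzOn Lφ φ X →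
        OPPM.IsProper ψ → OPPM.StronglyConvex 1 ψ → OPPM.CouplingLipschitzOn Lψ ψ Y →
        OPPM.IsBestResponse f x x' y y' X Y T →
        OPPM.pathLength x' y' T ≤ C →
        OPPM.IsPlay f x y X Y φ ψ
          (OPPM.rate f x x' y y' (max Lφ Lψ) (max DX DY) C ε)
          (OPPM.rate f x x' y y' (max Lφ Lψ) (max DX DY) C ε) p q T →
        OPPM.regret₁ f x x' y T ≤
            K * min (1 + OPPM.variability f X Y T) (Real.sqrt ((1 + C) * T)) ∧
          OPPM.regret₂ f x y y' T ≤
            K * min (1 + OPPM.variability f X Y T) (Real.sqrt ((1 + C) * T)) := by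
  set G := max GX GY
  set D := max DX DY
  set L := max Lφ Lψ
  set M := 6 * G ^ 2 * L * (2 * D + 1) + 2 * G * (2 * D + 1) * ε
    + (2 * G * (2 * D + 1) + 12 * (G * D)) + 1 with hM
  -- The variability bound gives `ε + 5 * (G * D) + 4 * V`, the other `ε + G * D + 2 * M * R`. The
  -- `max` with `1` is needed because the parameters are arbitrary reals, with signs known only once
  -- a game is given.
  set K := max 1 (4 + ε + 5 * (G * D) + 2 * M)
  have hK1 : 1 ≤ K := le_max_left _ _
  refine ⟨K, by linarith, ?_⟩
  intro E F _ _ _ _ X Y φ ψ T C f x x' y y' p q hX hXc hdX hY hYc hdY hf _ hφ hsφ hLφ hψ hsψ hLψ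
    hbr hC hplay
  have hV := OPPM.variability_nonneg (X := X) (Y := Y) (f := f) T
  have hmin : 0 ≤ min (1 + OPPM.variability f X Y T) (√((1 + C) * T)) :=
    le_min (by linarith) (Real.sqrt_nonneg _)
  have hDX : ∀ a ∈ X, ∀ b ∈ X, ‖a - b‖ ≤ DX := fun a ha b hb => by
    rw [← hdX, ← dist_eq_norm]; exact Metric.dist_le_diam_of_mem hX.isBounded ha hb
  have hDY : ∀ a ∈ Y, ∀ b ∈ Y, ‖a - b‖ ≤ DY := fun a ha b hb => by
    rw [← hdY, ← dist_eq_norm]; exact Metric.dist_le_diam_of_mem hY.isBounded ha hb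
  have hDX' : ∀ a ∈ X, ∀ b ∈ X, ‖a - b‖ ≤ D := fun a ha b hb =>
    (hDX a ha b hb).trans (le_max_left _ _)
  have hDY' : ∀ a ∈ Y, ∀ b ∈ Y, ‖a - b‖ ≤ D := fun a ha b hb =>
    (hDY a ha b hb).trans (le_max_right _ _)
  rcases T with _ | n
  · have h : 0 ≤ K * min (1 + OPPM.variability f X Y 0) (√((1 + C) * (0 : ℕ))) :=
      mul_nonneg (by linarith) hmin
    constructor <;> simpa only [OPPM.regret₁, OPPM.regret₂, Finset.Icc_eq_empty_of_lt zero_lt_one,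
      Finset.sum_empty, sub_zero] using h
  rcases le_or_gt D 0 with hD | hD
  · have h := OPPM.regret_nonpos (fun a ha b hb => (hDX' a ha b hb).trans hD)
      (fun a ha b hb => (hDY' a ha b hb).trans hD) hplay.mem_left hplay.mem_right hbr
    have : 0 ≤ K * min (1 + OPPM.variability f X Y (n + 1)) (√((1 + C) * (n + 1 : ℕ))) :=
      mul_nonneg (by linarith) hmin
    exact ⟨h.1.trans this, h.2.trans this⟩
  have hx1 := hplay.mem_left 1 le_rfl (by omega)
  have hy1 := hplay.mem_right 1 le_rfl (by omega)
  have hG : 0 ≤ G := by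
    obtain ⟨g, -, hg⟩ := (hf 1 le_rfl (by omega)).subgradient_left _ hx1 _ hy1
    exact (norm_nonneg g).trans (hg.trans (le_max_left _ _))
  -- A set of positive diameter contains a second point, where strong convexity makes the coupling
  -- positive and so forces a positive Lipschitz constant.
  have hL : 0 < L := by
    rcases lt_max_iff.1 hD with h | h
    · obtain ⟨b, hb, hne⟩ : ∃ b ∈ X, b ≠ x 1 := by
        by_contra! hall
        have hsub : X.Subsingleton := fun a ha b hb => (hall a ha).trans (hall b hb).symm
        rw [← hdX, Metric.diam_subsingleton hsub] at h
        exact lt_irrefl _ h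
      exact (hLφ.pos hφ hsφ hx1 hb hplay.init_left hne).trans_le (le_max_left _ _)
    · obtain ⟨b, hb, hne⟩ : ∃ b ∈ Y, b ≠ y 1 := by
        by_contra! hall
        have hsub : Y.Subsingleton := fun a ha b hb => (hall a ha).trans (hall b hb).symm
        rw [← hdY, Metric.diam_subsingleton hsub] at h
        exact lt_irrefl _ h
      exact (hLψ.pos hψ hsψ hy1 hb hplay.init_right hne).trans_le (le_max_right _ _)
  have hLφ' := hLφ.mono (le_max_left Lφ Lψ)
  have hLψ' := hLψ.mono (le_max_right Lφ Lψ)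
  have hGX : GX ≤ G := le_max_left _ _
  have hGY : GY ≤ G := le_max_right _ _
  have hreg := OPPM.regret_le_sum_delta hXc hYc hDX' hDY' hGX hGY hG hD hL hε hf hφ hsφ hLφ' hψ hsψ
    hLψ' hbr hC hplay
  have hvar := OPPM.sum_delta_le_variability hX hY hDX' hDY' hGX hGY hG hD.le hf hplay.mem_left
    hplay.mem_right hbr
  have hsqrt := OPPM.sum_delta_le_sqrt hXc hYc hDX' hDY' hGX hGY hG hD hL hε hf hφ hsφ hLφ' hψ hsψ
    hLψ' hbr hC hplay
  rw [← hM] at hsqrt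
  have hGD : 0 ≤ G * D := by positivity
  have hM0 : 0 ≤ M := by positivity
  have hKM : 4 + ε + 5 * (G * D) + 2 * M ≤ K := le_max_right _ _
  have hC0 : 0 ≤ C := (OPPM.pathLength_nonneg _).trans hC
  have hR1 : 1 ≤ √((1 + C) * (n + 1 : ℕ)) := by
    rw [Real.one_le_sqrt]
    push_cast
    nlinarith [mul_nonneg hC0 n.cast_nonneg, (n.cast_nonneg : (0 : ℝ) ≤ n)]
  have hbound : ε + G * D + 2 * ∑ t ∈ Finset.Icc 1 n, OPPM.delta f x x' y y' t
      ≤ K * min (1 + OPPM.variability f X Y (n + 1)) (√((1 + C) * (n + 1 : ℕ))) := by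
    rw [mul_min_of_nonneg _ _ (by linarith : 0 ≤ K)]
    refine le_min ?_ ?_
    · nlinarith [mul_le_mul_of_nonneg_right (by linarith : 4 ≤ K) hV]
    · have h1 := mul_le_mul_of_nonneg_right hKM (Real.sqrt_nonneg ((1 + C) * (n + 1 : ℕ)))
      nlinarith [mul_le_mul_of_nonneg_left hR1 (by linarith : 0 ≤ ε + G * D),
        mul_nonneg hGD (Real.sqrt_nonneg ((1 + C) * (n + 1 : ℕ)))]
  exact ⟨hreg.1.trans hbound, hreg.2.trans hbound⟩
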